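/- Let $X$ be a real Hilbert space with dual space $X^*$ and dual bracket $\langle\cdot,\cdot\rangle$. For a densely defined linear operator $T:E\supset D(T)\to F$ between Banach spaces, $T^*:F^*\supset D(T^*)\to E^*$ denotes its dual operator, and $X^{**}$ is identified with $X$. Let $J:X^*\supset D(J)\to X$ and $L:X\to X^*$ be linear operators such that: - **(H1)** $J$ is densely defined and anti-self-dual: $J^*=-J$ (including equality of the domains). - **(H2)** $L$ is bounded and symmetric, i.e. $\langle Lu,v\rangle=\langle Lv,u\rangle$ for all $u,v\in X$, and $X$ is the direct sum of three closed subspaces, $X=X_-\oplus\ker L\oplus X_+$, with $n^-(L):=\dim X_-<\infty$, where $\langle Lu,u\rangle<0$ for all $u\in X_-\setminus\{0\}$, and where for some $\delta>0$ one has $\langle Lu,u\rangle\ge\delta\|u\|^2$ for all $u\in X_+$. - **(H3)** For these $X_\pm$, every $f\in X^*$ with $\langle f,u\rangle=0$ for all $u\in X_-\oplus X_+$ belongs to $D(J)$. Let $JL$ be the composition with domain $D(JL)=\{u\in X: Lu\in D(J)\}$. Assume in addition that $L$ is non-degenerate, i.e. $$\inf_{v\ne0}\ \sup_{u\neq 0}\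 \frac{|\langle Lu,v\rangle|}{\|u\|\,\|v\|}>0,$$ with the convention that the infimum over the empty set is $+\infty$ (so that the condition holds if $X=\{0\}$). Then: 1. every linear subspace $W\subset X$ with $\langle Lu,u\rangle\le0$ for all $u\in W$ satisfies $\dim W\le n^-(L)$; 2. there exists a linear subspace $W\subset D(JL)$ such that $\dim W=n^-(L)$, $JL(W)\subset W$, and $\langle Lu,u\rangle\le0$ for all $u\in W$. -/

import Mathlib

namespace LinHam

section Dual

variable {E F : Type*} [NormedAddCommGroup E] [NormedSpace ℝ E]
  [NormedAddCommGroup F] [NormedSpace ℝ F]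

/-- The graph of the dual operator of a (partially defined) linear operator `T : E ⊃ D(T) → F`:
the pairs `(f, g)` in `F* × E*` such that `⟨g, x⟩ = ⟨f, T x⟩` for every `x ∈ D(T)`. -/
def dualGraph (T : E →ₗ.[ℝ] F) : Submodule ℝ (StrongDual ℝ F × StrongDual ℝ E) where
  carrier := {p | ∀ x : T.domain, p.2 (x : E) = p.1 (T x)}
  add_mem' := by
    intro a b ha hb x
    simp [ha x, hb x]
  zero_mem' := by
    intro x
    simp
  smul_mem' := by
    intro c a ha x
    simp [ha x]

/-- The dual operator `T* : F* ⊃ D(T*) → E*` of a densely defined linear operator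
`T : E ⊃ D(T) → F`. It is meaningful when `D(T)` is dense, see `dualOp_graph`. -/
noncomputable def dualOp (T : E →ₗ.[ℝ] F) : StrongDual ℝ F →ₗ.[ℝ] StrongDual ℝ E :=
  (dualGraph T).toLinearPMap

/-- For a densely defined operator, `dualGraph T` really is the graph of `dualOp T`. -/
theorem dualOp_graph (T : E →ₗ.[ℝ] F) (hT : Dense (T.domain : Set E)) :
    (dualOp T).graph = dualGraph T := by
  apply Submodule.toLinearPMap_graph_eq
  rintro ⟨f, g⟩ hp hf
  simp only at hf
  subst hf
  have h : Set.EqOn g (0 : StrongDual ℝ E) (T.domain : Set E) := by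
    intro x hx
    simpa using hp ⟨x, hx⟩
  exact ContinuousLinearMap.ext fun x =>
    congrFun (Continuous.ext_on hT g.continuous (0 : StrongDual ℝ E).continuous h) x

end Dual

section Operators

variable {X : Type*} [NormedAddCommGroup X] [InnerProductSpace ℝ X]

/-- `J : X* ⊃ D(J) → X` is anti-self-dual: it is densely defined and `J* = -J`, where
`J* : X* ⊃ D(J*) → X**` is the dual operator and `X` is regarded as a subspace of `X**` through
the canonical embedding (which is onto for a Hilbert space). The equality of partially defined
operators includes the equality of their domains. -/
def IsAntiSelfDual (J : StrongDual ℝ X →ₗ.[ℝ] X) : Prop :=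
  Dense (J.domain : Set (StrongDual ℝ X)) ∧
    dualOp J = (NormedSpace.inclusionInDoubleDual ℝ X).toLinearMap.compPMap (-J)

/-- The hypotheses (H1), (H2), (H3) on the pair `(J, L)`, with `X = X₋ ⊕ ker L ⊕ X₊` the
decomposition of (H2) that is also referred to in (H3). The number `n⁻(L)` is `dim X₋`. -/
structure Hypotheses (J : StrongDual ℝ X →ₗ.[ℝ] X) (L : X →L[ℝ] StrongDual ℝ X)
    (Xm Xp : Submodule ℝ X) : Prop where
  antiSelfDual : IsAntiSelfDual J
  symmetric : ∀ u v : X, L u v = L v u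
  closed_neg : IsClosed (Xm : Set X)
  closed_pos : IsClosed (Xp : Set X)
  decomposition : DirectSum.IsInternal
    (![Xm, LinearMap.ker L.toLinearMap, Xp] : Fin 3 → Submodule ℝ X)
  finite_neg : FiniteDimensional ℝ Xm
  negative : ∀ u ∈ Xm, u ≠ 0 → L u u < 0
  positive : ∃ δ : ℝ, 0 < δ ∧ ∀ u ∈ Xp, δ * ‖u‖ ^ 2 ≤ L u u
  annihilator_le : ∀ f : StrongDual ℝ X, (∀ u ∈ Xm ⊔ Xp, f u = 0) → f ∈ J.domain

/-- Non-degeneracy of the form `⟨L u, v⟩`: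
`inf_{v ≠ 0} sup_{u ≠ 0} |⟨L u, v⟩| / (‖u‖ ‖v‖) > 0`, the infimum and the supremum being taken
in `[0, ∞]`. -/
def IsNondegenerate (L : X →L[ℝ] StrongDual ℝ X) : Prop :=
  0 < ⨅ (v : X) (_ : v ≠ 0), ⨆ (u : X) (_ : u ≠ 0), ENNReal.ofReal (|L u v| / (‖u‖ * ‖v‖))

/-- The composition `J L`, with its natural domain `D(JL) = {u ∈ X | L u ∈ D(J)}`. -/
noncomputable def opJL (J : StrongDual ℝ X →ₗ.[ℝ] X) (L : X →L[ℝ] StrongDual ℝ X) : X →ₗ.[ℝ] X where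
  domain := J.domain.comap L.toLinearMap
  toFun :=
    { toFun := fun u => J ⟨L u, u.2⟩
      map_add' := by
        intro u v
        rw [← J.map_add]
        congr 1
        ext1
        simp
      map_smul' := by
        intro c u
        rw [RingHom.id_apply, ← J.map_smul]
        congr 1
        ext1
        simp }

end Operators

end LinHam

/-! Nondegeneracy and symmetry make `L` an isomorphism `X → X*`, so `X = X₋ ⊕ X₊`. On a nonpositive
subspace the projection onto `X₋` along `X₊` is injective, which bounds its dimension
(`rank_le_of_nonpos`).

For existence, put `A = JL`. Since `J* = -J` and `L` is an isomorphism, `A` is densely defined and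
equals minus its adjoint for the form `⟨L·,·⟩`: this is Pontryagin's invariant subspace theorem.
Perturbing a basis of `X₋` gives a negative definite `N ⊂ D(A)` of the same dimension, and `N^⊥` is
uniformly positive (`exists_projection`). For each finite-dimensional `V` with `N ⊂ V ⊂ D(A)`, the
compression of `A` to `V` is skew, and the finite-dimensional theorem
`exists_invariant_nonpos_of_finrank` gives it an invariant nonpositive subspace of dimension `dim
N`.

These subspaces are graphs over `N` with a common bound, and the compressions are uniformly bounded
on them, because the `N`-component of an image only involves `A` on `N`. As `V` grows, their weak
limits form a nonpositive subspace that still projects onto `N`. The limiting relation `⟨Lw, Av⟩ =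
-⟨Lz, v⟩` for all `v ∈ D(A)` forces `w ∈ D(A)` and `Aw = z` (`exists_invariant_nonpos`). -/

namespace LinHam

open Module Polynomial

/-! ### Skew endomorphisms of a finite-dimensional space with an indefinite form. -/

section FiniteDimensional

/-- A real endomorphism has an eigenvector, or a vector annihilated by a quadratic polynomial
without real roots. -/
theorem exists_eigenvector_or_quadratic {V : Type*} [AddCommGroup V] [Module ℝ V]
    [FiniteDimensional ℝ V] [Nontrivial V] (A : V →ₗ[ℝ] V) :
    ∃ u : V, u ≠ 0 ∧ ((∃ c : ℝ, A u = c • u) ∨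
      ∃ b c : ℝ, b ^ 2 < 4 * c ∧ A (A u) = -(b • A u) - c • u) := by
  have hint : IsIntegral ℝ A := Algebra.IsIntegral.isIntegral A
  have hpos := minpoly.natDegree_pos hint
  obtain ⟨n, hn⟩ := Nat.exists_eq_succ_of_ne_zero hpos.ne'
  have hmon : (minpoly ℝ A).IsMonicOfDegree (n + 1) := ⟨hn, minpoly.monic hint⟩
  obtain ⟨f, g, hf, hfg⟩ := hmon.eq_isMonicOfDegree_one_or_two_mul
  have hfm : f.Monic := hf.elim (·.monic) (·.monic)
  have hgm : g.Monic := hfm.of_mul_monic_left (hfg ▸ minpoly.monic hint)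
  -- The cofactor `g` is a proper divisor of the minimal polynomial, so some `u = g(A)v` is nonzero,
  -- and `f(A)` kills it.
  have hg : aeval A g ≠ 0 := by
    apply minpoly.aeval_ne_zero_of_dvdNotUnit_minpoly hint hgm
    refine ⟨hgm.ne_zero, f, ?_, by rw [hfg, mul_comm]⟩
    intro hu
    have := natDegree_eq_zero_of_isUnit hu
    rcases hf with h | h <;> have := h.natDegree_eq <;> omega
  obtain ⟨v, hv⟩ : ∃ v, aeval A g v ≠ 0 := by
    by_contra! h
    exact hg (LinearMap.ext h)
  have hfv : aeval A f (aeval A g v) = 0 := by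
    have h := minpoly.aeval ℝ A
    rw [hfg, map_mul] at h
    exact LinearMap.congr_fun h v
  set u := aeval A g v
  rcases hf with hf | hf
  · obtain ⟨r, rfl⟩ := isMonicOfDegree_one_iff.mp hf
    refine ⟨u, hv, Or.inl ⟨-r, ?_⟩⟩
    simp [Algebra.algebraMap_eq_smul_one] at hfv
    rw [neg_smul]
    exact eq_neg_of_add_eq_zero_left hfv
  · obtain ⟨b, c, rfl⟩ := isMonicOfDegree_two_iff.mp hf
    simp [Algebra.algebraMap_eq_smul_one, pow_two] at hfv
    have hAA : A (A u) = -(b • A u) - c • u := by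
      rw [eq_sub_iff_add_eq, eq_neg_iff_add_eq_zero, ← hfv]
      abel
    by_cases hbc : b ^ 2 < 4 * c
    · exact ⟨u, hv, Or.inr ⟨b, c, hbc, hAA⟩⟩
    · have hs : Real.sqrt (b ^ 2 - 4 * c) ^ 2 = b ^ 2 - 4 * c := Real.sq_sqrt (by linarith)
      set s := Real.sqrt (b ^ 2 - 4 * c)
      -- With real roots the quadratic splits: either `u` is an eigenvector for one root, or `A u -
      -- root • u` is one for the other.
      by_cases hw : A u - ((-b + s) / 2) • u = 0
      · exact ⟨u, hv, Or.inl ⟨_, sub_eq_zero.mp hw⟩⟩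
      · refine ⟨_, hw, Or.inl ⟨(-b - s) / 2, ?_⟩⟩
        have hc : c = (b ^ 2 - s ^ 2) / 4 := by linarith
        rw [map_sub, map_smul, hAA, hc]
        module

variable {V : Type*} [AddCommGroup V] [Module ℝ V]

/-- Orthogonal projection onto a finite-dimensional subspace on which the form is anisotropic. -/
theorem exists_orthogonal_projection (B : V →ₗ[ℝ] V →ₗ[ℝ] ℝ) (U : Submodule ℝ V)
    [FiniteDimensional ℝ U] (hU : ∀ u ∈ U, B u u = 0 → u = 0) :
    ∃ p : V →ₗ[ℝ] U, ∀ x, ∀ v ∈ U, B (p x) v = B x v := by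
  let G : U →ₗ[ℝ] Dual ℝ U := (B.domRestrict₁₂ U U)
  have hG : Function.Injective G := by
    rw [← LinearMap.ker_eq_bot, LinearMap.ker_eq_bot']
    intro u hu
    exact Subtype.ext (hU u u.2 (LinearMap.congr_fun hu u))
  let e := LinearEquiv.ofInjectiveOfFinrankEq G hG (Subspace.dual_finrank_eq).symm
  refine ⟨e.symm.toLinearMap ∘ₗ (LinearMap.lcomp ℝ ℝ U.subtype) ∘ₗ B, fun x v hv => ?_⟩
  have : e (e.symm (LinearMap.lcomp ℝ ℝ U.subtype (B x))) = LinearMap.lcomp ℝ ℝ U.subtype (B x) :=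
    e.apply_symm_apply _
  exact LinearMap.congr_fun this ⟨v, hv⟩

/-- The orthogonal complement of a subspace for a bilinear form. -/
def perp (B : V →ₗ[ℝ] V →ₗ[ℝ] ℝ) (U : Submodule ℝ V) : Submodule ℝ V where
  carrier := {x | ∀ u ∈ U, B x u = 0}
  add_mem' := by
    intro a b ha hb u hu
    simp [ha u hu, hb u hu]
  zero_mem' := by
    intro u _
    simp
  smul_mem' := by
    intro c a ha u hu
    simp [ha u hu]

/-- `N ⊓ perp B U` is the kernel of `N → U*`; no nondegeneracy is needed. -/
theorem finrank_le_add_finrank_inf_perp [FiniteDimensional ℝ V] (B : V →ₗ[ℝ] V →ₗ[ℝ] ℝ)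
    (N U : Submodule ℝ V) :
    finrank ℝ N ≤ finrank ℝ U + finrank ℝ (N ⊓ perp B U : Submodule ℝ V) := by
  let φ : N →ₗ[ℝ] Dual ℝ U := B.domRestrict₁₂ N U
  have h1 := φ.finrank_range_add_finrank_ker
  have h2 : finrank ℝ (LinearMap.range φ) ≤ finrank ℝ U :=
    (Submodule.finrank_le _).trans Subspace.dual_finrank_eq.le
  have h3 : finrank ℝ (LinearMap.ker φ) ≤ finrank ℝ (N ⊓ perp B U : Submodule ℝ V) := by
    rw [(Submodule.equivMapOfInjective N.subtype N.injective_subtype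
      (LinearMap.ker φ)).finrank_eq]
    apply Submodule.finrank_mono
    rintro _ ⟨x, hx, rfl⟩
    exact ⟨x.2, fun u hu => LinearMap.congr_fun (LinearMap.mem_ker.mp hx) ⟨u, hu⟩⟩
  omega

/-- A skew endomorphism has an invariant subspace on which the form is nonpositive or positive
definite. -/
theorem exists_invariant_semidefinite [FiniteDimensional ℝ V] [Nontrivial V]
    {B : V →ₗ[ℝ] V →ₗ[ℝ] ℝ} (hB : ∀ u v, B u v = B v u) {A : V →ₗ[ℝ] V}
    (hA : ∀ u v, B (A u) v = -B u (A v)) :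
    ∃ U : Submodule ℝ V, U ≠ ⊥ ∧ (∀ u ∈ U, A u ∈ U) ∧
      ((∀ u ∈ U, B u u ≤ 0) ∨ ∀ u ∈ U, u ≠ 0 → 0 < B u u) := by
  obtain ⟨u, hu, ⟨c, hc⟩ | ⟨b, c, hbc, hAA⟩⟩ := exists_eigenvector_or_quadratic A
  · refine ⟨Submodule.span ℝ {u}, by simpa using hu, ?_, ?_⟩
    · intro v hv
      obtain ⟨t, rfl⟩ := Submodule.mem_span_singleton.mp hv
      rw [map_smul, hc, smul_smul]
      exact Submodule.smul_mem _ _ (Submodule.mem_span_singleton_self u)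
    · rcases le_or_gt (B u u) 0 with h | h
      · left
        intro v hv
        obtain ⟨t, rfl⟩ := Submodule.mem_span_singleton.mp hv
        simp only [map_smul, LinearMap.smul_apply, smul_eq_mul]
        nlinarith [mul_self_nonneg t]
      · right
        intro v hv hv0
        obtain ⟨t, rfl⟩ := Submodule.mem_span_singleton.mp hv
        have ht : t ≠ 0 := by
          rintro rfl
          simp at hv0
        simp only [map_smul, LinearMap.smul_apply, smul_eq_mul]
        rw [← mul_assoc]
        exact mul_pos (mul_self_pos.mpr ht) h
  · have h0 : B (A u) u = 0 := by
      have := hA u u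
      rw [hB u] at this
      linarith
    have h0' : B u (A u) = 0 := by rw [hB, h0]
    have h1 : B (A u) (A u) = c * B u u := by
      rw [hA, hAA]
      simp [h0']
    -- Skewness makes `u` and `A u` orthogonal with squares in ratio `1 : c`, and `c > 0`, so the
    -- whole plane has the sign of `B u u`.
    have key : ∀ x y : ℝ, B (x • u + y • A u) (x • u + y • A u) =
        (x ^ 2 + c * y ^ 2) * B u u := by
      intro x y
      simp only [map_add, map_smul, LinearMap.add_apply, LinearMap.smul_apply, smul_eq_mul, h0, h0',
        h1]
      ring
    have hc0 : 0 < c := by nlinarith [sq_nonneg b]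
    refine ⟨Submodule.span ℝ {u, A u}, ?_, ?_, ?_⟩
    · intro h
      apply hu
      have : u ∈ Submodule.span ℝ {u, A u} := Submodule.subset_span (by simp)
      rwa [h, Submodule.mem_bot] at this
    · intro v hv
      obtain ⟨x, y, rfl⟩ := Submodule.mem_span_pair.mp hv
      rw [Submodule.mem_span_pair]
      refine ⟨-(y * c), x - y * b, ?_⟩
      rw [map_add, map_smul, map_smul, hAA]
      module
    · rcases le_or_gt (B u u) 0 with h | h
      · left
        intro v hv
        obtain ⟨x, y, rfl⟩ := Submodule.mem_span_pair.mp hv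
        rw [key]
        exact mul_nonpos_of_nonneg_of_nonpos (by positivity) h
      · right
        intro v hv hv0
        obtain ⟨x, y, rfl⟩ := Submodule.mem_span_pair.mp hv
        rw [key]
        refine mul_pos ?_ h
        by_contra! hle
        have hx : x = 0 := by
          have : x ^ 2 ≤ 0 := by nlinarith [sq_nonneg y, mul_nonneg hc0.le (sq_nonneg y)]
          exact pow_eq_zero_iff two_ne_zero |>.mp (le_antisymm this (sq_nonneg x))
        have hy : y = 0 := by
          have : y ^ 2 ≤ 0 := by
            by_contra! h'
            nlinarith [mul_pos hc0 h', sq_nonneg x]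
          exact pow_eq_zero_iff two_ne_zero |>.mp (le_antisymm this (sq_nonneg y))
        exact hv0 (by simp [hx, hy])

/-- **Pontryagin's theorem in finite dimension**: if the form is negative definite on `N`, then an
endomorphism that is skew with respect to the form has an invariant nonpositive subspace of
dimension at least `dim N`. -/
theorem exists_invariant_nonpos_of_finrank (n : ℕ) :
    ∀ {V : Type*} [AddCommGroup V] [Module ℝ V] [FiniteDimensional ℝ V]
    {B : V →ₗ[ℝ] V →ₗ[ℝ] ℝ} (_ : ∀ u v, B u v = B v u) {A : V →ₗ[ℝ] V}
    (_ : ∀ u v, B (A u) v = -B u (A v)) {N : Submodule ℝ V} (_ : ∀ u ∈ N, u ≠ 0 → B u u < 0)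
    (_ : finrank ℝ V = n),
    ∃ W : Submodule ℝ V, (∀ w ∈ W, A w ∈ W) ∧ (∀ w ∈ W, B w w ≤ 0) ∧
      finrank ℝ N ≤ finrank ℝ W := by
  induction n using Nat.strong_induction_on with
  | _ n ih =>
  intro V _ _ _ B hB A hA N hN hV
  rcases subsingleton_or_nontrivial V with hs | hs
  · exact ⟨⊤, fun _ _ => trivial, fun w _ => by simp [Subsingleton.elim w 0],
      Submodule.finrank_mono le_top⟩
  obtain ⟨U, hU0, hAU, hU⟩ := exists_invariant_semidefinite hB hA
  have hAp : ∀ x ∈ perp B U, A x ∈ perp B U := by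
    intro x hx u hu
    rw [hA, hx _ (hAU u hu), neg_zero]
  rcases hU with hU | hU
  -- `U` nonpositive: form and operator descend to `U^⊥ / (U ∩ U^⊥)`, modelled by `C`. Passing to `N
  -- ∩ U^⊥` costs at most `dim U`, which is regained by adding `U` to the subspace found in `C`.
  · obtain ⟨D, hD⟩ := Submodule.exists_isCompl (U ⊓ perp B U)
    let C : Submodule ℝ V := perp B U ⊓ D
    let π : V →ₗ[ℝ] V := D.projection _ hD.symm
    have hπ : ∀ x, x - π x ∈ U ⊓ perp B U := fun x => Submodule.sub_projection_mem hD.symm x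
    have hπC : ∀ x ∈ perp B U, π x ∈ C := fun x hx =>
      ⟨by simpa using sub_mem hx (hπ x).2, Submodule.projection_apply_mem hD.symm x⟩
    have hπB : ∀ x, ∀ y ∈ perp B U, B (π x) y = B x y := by
      intro x y hy
      have := hy _ (hπ x).1
      rw [hB, map_sub, LinearMap.sub_apply] at this
      linarith
    have hCU : Disjoint C U := by
      rw [Submodule.disjoint_def]
      intro x hx hxU
      exact (Submodule.disjoint_def.mp hD.disjoint) x ⟨hxU, hx.1⟩ hx.2
    have hUpos : 0 < finrank ℝ U := by
      rw [Nat.pos_iff_ne_zero, Ne, Submodule.finrank_eq_zero]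
      exact hU0
    have hCdim : finrank ℝ C < n := by
      have h1 := Submodule.finrank_sup_add_finrank_inf_eq C U
      have h2 := Submodule.finrank_le (C ⊔ U)
      rw [hCU.eq_bot, finrank_bot] at h1
      omega
    let AC : C →ₗ[ℝ] C := (π ∘ₗ A ∘ₗ C.subtype).codRestrict C fun x => hπC _ (hAp _ x.2.1)
    let BC : C →ₗ[ℝ] C →ₗ[ℝ] ℝ := B.domRestrict₁₂ C C
    have hAC : ∀ u v : C, BC (AC u) v = -BC u (AC v) := by
      intro u v
      change B (π (A u)) v = -B u (π (A v))
      rw [hπB _ _ v.2.1, hA, hB u, hB u, hπB _ _ u.2.1]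
    let N' : Submodule ℝ V := (N ⊓ perp B U).map π
    have hN'C : N' ≤ C := by
      rintro _ ⟨x, hx, rfl⟩
      exact hπC x hx.2
    have hker : ∀ x ∈ N ⊓ perp B U, π x = 0 → x = 0 := by
      intro x hx h0
      by_contra hne
      have h1 := hN x hx.1 hne
      have h2 := hπ x
      rw [h0, sub_zero] at h2
      exact h1.ne (hx.2 x h2.1)
    have hN'dim : finrank ℝ N' = finrank ℝ (N ⊓ perp B U : Submodule ℝ V) := by
      have hinj : Function.Injective (π.domRestrict (N ⊓ perp B U)) := by
        rw [← LinearMap.ker_eq_bot, LinearMap.ker_eq_bot']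
        intro x hx
        exact Subtype.ext (hker x x.2 hx)
      have := LinearMap.finrank_range_of_inj hinj
      rwa [LinearMap.range_domRestrict] at this
    obtain ⟨W, hW1, hW2, hW3⟩ := ih _ hCdim (B := BC) (fun u v => hB u v) hAC
      (N := N'.comap C.subtype) (by
        rintro ⟨_, hx'⟩ ⟨x, hx, rfl⟩ hne
        change B (π x) (π x) < 0
        rw [hπB _ _ (hπC x hx.2).1, hB, hπB _ _ hx.2]
        apply hN x hx.1
        rintro rfl
        exact hne (Subtype.ext (map_zero π))) rfl
    have hmem : ∀ w ∈ W.map C.subtype, w ∈ C := by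
      rintro _ ⟨w, _, rfl⟩
      exact w.2
    refine ⟨W.map C.subtype ⊔ U, ?_, ?_, ?_⟩
    · intro x hx
      obtain ⟨_, ⟨w, hw, rfl⟩, u, hu, rfl⟩ := Submodule.mem_sup.mp hx
      rw [map_add]
      refine add_mem ?_ (Submodule.mem_sup_right (hAU u hu))
      have h : A w = π (A w) + (A w - π (A w)) := by abel
      change A w ∈ _
      rw [h]
      exact add_mem (Submodule.mem_sup_left ⟨_, hW1 w hw, rfl⟩)
        (Submodule.mem_sup_right (hπ _).1)
    · intro x hx
      obtain ⟨_, ⟨w, hw, rfl⟩, u, hu, rfl⟩ := Submodule.mem_sup.mp hx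
      have h1 : B w w ≤ 0 := hW2 w hw
      have h2 := hU u hu
      have h3 : B w u = 0 := w.2.1 u hu
      have h4 : B u w = 0 := by rw [hB, h3]
      simp only [Submodule.subtype_apply, map_add, LinearMap.add_apply, h3, h4]
      linarith
    · have h1 := Submodule.finrank_sup_add_finrank_inf_eq (W.map C.subtype) U
      have h2 : W.map C.subtype ⊓ U = ⊥ := (hCU.mono_left hmem).eq_bot
      have h3 : finrank ℝ (W.map C.subtype) = finrank ℝ W :=
        (Submodule.equivMapOfInjective _ C.injective_subtype W).finrank_eq.symm
      have h4 : finrank ℝ (N'.comap C.subtype) = finrank ℝ N' :=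
        (Submodule.comapSubtypeEquivOfLe hN'C).finrank_eq
      have h5 := finrank_le_add_finrank_inf_perp B N U
      rw [h2, finrank_bot] at h1
      omega
  -- `U` positive definite: `U` splits off orthogonally, and removing the `U`-component of a vector
  -- of `N` only makes the form more negative.
  · obtain ⟨p, hp⟩ := exists_orthogonal_projection B U fun u hu h => by
      by_contra hne
      exact (hU u hu hne).ne' h
    let C := perp B U
    let π : V →ₗ[ℝ] V := LinearMap.id - U.subtype ∘ₗ p
    have hπ : ∀ x, π x = x - p x := fun x => rfl
    have hπC : ∀ x, π x ∈ C := by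
      intro x u hu
      rw [hπ, map_sub, LinearMap.sub_apply, hp x u hu, sub_self]
    have hneg : ∀ x ∈ N, x ≠ 0 → B (π x) (π x) < 0 := by
      intro x hx hne
      have h1 := hN x hx hne
      have h2 : 0 ≤ B (p x) (p x) := by
        by_cases h : (p x : V) = 0
        · simp [h]
        · exact (hU _ (p x).2 h).le
      have h3 := hp x _ (p x).2
      have h4 : B (p x) x = B x (p x) := hB _ _
      rw [hπ]
      simp only [map_sub, LinearMap.sub_apply]
      linarith
    have hUpos : 0 < finrank ℝ U := by
      rw [Nat.pos_iff_ne_zero, Ne, Submodule.finrank_eq_zero]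
      exact hU0
    have hCU : Disjoint C U := by
      rw [Submodule.disjoint_def]
      intro x hx hxU
      by_contra hne
      exact (hU x hxU hne).ne' (hx x hxU)
    have hCdim : finrank ℝ C < n := by
      have h1 := Submodule.finrank_sup_add_finrank_inf_eq C U
      have h2 := Submodule.finrank_le (C ⊔ U)
      rw [hCU.eq_bot, finrank_bot] at h1
      omega
    have hN'C : N.map π ≤ C := by
      rintro _ ⟨x, _, rfl⟩
      exact hπC x
    obtain ⟨W, hW1, hW2, hW3⟩ := ih _ hCdim (B := B.domRestrict₁₂ C C) (fun u v => hB u v)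
      (A := A.restrict hAp) (fun u v => hA u v) (N := (N.map π).comap C.subtype) (by
        rintro ⟨_, hx'⟩ ⟨x, hx, rfl⟩ hne
        apply hneg x hx
        rintro rfl
        exact hne (Subtype.ext (map_zero π))) rfl
    refine ⟨W.map C.subtype, ?_, ?_, ?_⟩
    · rintro _ ⟨w, hw, rfl⟩
      exact ⟨_, hW1 w hw, rfl⟩
    · rintro _ ⟨w, hw, rfl⟩
      exact hW2 w hw
    · have hinj : Function.Injective (π.domRestrict N) := by
        rw [← LinearMap.ker_eq_bot, LinearMap.ker_eq_bot']
        intro x hx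
        by_contra hne
        have := hneg x x.2 fun h => hne (Subtype.ext h)
        have hx' : π x = 0 := hx
        simp [hx'] at this
      have h1 := LinearMap.finrank_range_of_inj hinj
      rw [LinearMap.range_domRestrict] at h1
      have h3 : finrank ℝ (W.map C.subtype) = finrank ℝ W :=
        (Submodule.equivMapOfInjective _ C.injective_subtype W).finrank_eq.symm
      have h4 : finrank ℝ ((N.map π).comap C.subtype) = finrank ℝ (N.map π) :=
        (Submodule.comapSubtypeEquivOfLe hN'C).finrank_eq
      omega

end FiniteDimensional

/-! ### Geometry of a nondegenerate form of finite negative index on a Hilbert space. -/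

open Module Filter Topology

section Forms

variable {X : Type*} [NormedAddCommGroup X] [InnerProductSpace ℝ X]

theorem exists_bound_below {L : X →L[ℝ] StrongDual ℝ X} (hsymm : ∀ u v, L u v = L v u)
    (hL : IsNondegenerate L) : ∃ c : ℝ, 0 < c ∧ ∀ v, c * ‖v‖ ≤ ‖L v‖ := by
  -- The infimum is infinite when `X = {0}`, so a finite `r` below it is taken.
  obtain ⟨r, hr0, hr⟩ := ENNReal.lt_iff_exists_nnreal_btwn.mp hL
  refine ⟨r, by exact_mod_cast hr0, fun v => ?_⟩
  by_cases hv : v = 0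
  · simp [hv]
  have hv' : 0 < ‖v‖ := norm_pos_iff.mpr hv
  have h1 : (r : ENNReal) ≤ ENNReal.ofReal (‖L v‖ / ‖v‖) := by
    refine hr.le.trans ((iInf₂_le v hv).trans (iSup₂_le fun u hu => ?_))
    apply ENNReal.ofReal_le_ofReal
    have hu' : 0 < ‖u‖ := norm_pos_iff.mpr hu
    rw [div_le_div_iff₀ (by positivity) hv', hsymm u v]
    have := (L v).le_opNorm u
    rw [Real.norm_eq_abs] at this
    nlinarith
  rw [← ENNReal.ofReal_coe_nnreal, ENNReal.ofReal_le_ofReal_iff (by positivity)] at h1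
  rwa [le_div_iff₀ hv'] at h1

/-- After Riesz identification, `L` is a symmetric operator with closed range, and the orthogonal
complement of that range is its kernel. -/
theorem surjective_of_bound_below [CompleteSpace X] {L : X →L[ℝ] StrongDual ℝ X}
    (hsymm : ∀ u v, L u v = L v u) {c : ℝ} (hc : 0 < c) (hbd : ∀ v, c * ‖v‖ ≤ ‖L v‖) :
    Function.Surjective L := by
  let e := (InnerProductSpace.toDual ℝ X).symm
  let T : X →ₗ[ℝ] X := e.toLinearEquiv.toLinearMap ∘ₗ L.toLinearMap
  have hT : ∀ u v, inner ℝ (T u) v = L u v := fun u v =>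
    InnerProductSpace.toDual_symm_apply
  have hTn : ∀ u, ‖T u‖ = ‖L u‖ := fun u => e.norm_map _
  have hclosed : IsClosed (LinearMap.range T : Set X) := by
    have hanti : AntilipschitzWith (Real.toNNReal c⁻¹) T := by
      apply AddMonoidHomClass.antilipschitz_of_bound T
      intro x
      rw [Real.coe_toNNReal _ (by positivity), hTn, inv_mul_eq_div, le_div_iff₀ hc, mul_comm]
      exact hbd x
    have := hanti.isClosed_range (LipschitzWith.uniformContinuous (K := ‖L‖₊)
      (AddMonoidHomClass.lipschitz_of_bound_nnnorm T _ fun x => by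
        have : ‖T x‖ ≤ ‖L‖ * ‖x‖ := by
          rw [hTn]
          exact L.le_opNorm x
        exact_mod_cast this))
    rwa [LinearMap.coe_range]
  have : CompleteSpace (LinearMap.range T) := hclosed.completeSpace_coe
  have htop : LinearMap.range T = ⊤ := by
    rw [← Submodule.orthogonal_eq_bot_iff, Submodule.eq_bot_iff]
    intro v hv
    rw [Submodule.mem_orthogonal] at hv
    have h0 : L v = 0 := by
      ext u
      rw [hsymm, ← hT]
      exact hv _ ⟨u, rfl⟩
    have := hbd v
    rw [h0, norm_zero] at this
    exact norm_le_zero_iff.mp (by nlinarith [norm_nonneg v])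
  intro f
  obtain ⟨u, hu⟩ := LinearMap.range_eq_top.mp htop (e f)
  exact ⟨u, e.injective hu⟩

/-- The bilinear form of `L`, without its topology. -/
noncomputable def formOf (L : X →L[ℝ] StrongDual ℝ X) : X →ₗ[ℝ] X →ₗ[ℝ] ℝ :=
  ContinuousLinearMap.coeLM ℝ ∘ₗ L.toLinearMap

/-- Compactness of the unit sphere of `N`; the sphere is empty exactly when `N` is zero. -/
theorem exists_uniform_negative (L : X →L[ℝ] StrongDual ℝ X) (N : Submodule ℝ X)
    [FiniteDimensional ℝ N] (hN : ∀ u ∈ N, u ≠ 0 → L u u < 0) :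
    ∃ ν : ℝ, 0 < ν ∧ ∀ u ∈ N, L u u ≤ -(ν * ‖u‖ ^ 2) := by
  have hcont : Continuous fun u : N => L u u :=
    L.continuous.comp continuous_subtype_val |>.clm_apply continuous_subtype_val
  rcases (Metric.sphere (0 : N) 1).eq_empty_or_nonempty with he | hne
  · refine ⟨1, one_pos, fun u hu => ?_⟩
    by_cases h0 : u = 0
    · simp [h0]
    · exfalso
      have : (‖u‖⁻¹ • (⟨u, hu⟩ : N)) ∈ Metric.sphere (0 : N) 1 := by
        rw [mem_sphere_zero_iff_norm, norm_smul]
        simp [h0]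
      rw [he] at this
      exact this
  · obtain ⟨m, hm, hmax⟩ := (isCompact_sphere (0 : N) 1).exists_isMaxOn hne hcont.continuousOn
    rw [mem_sphere_zero_iff_norm] at hm
    have hm0 : (m : X) ≠ 0 := by
      intro h
      have h' : m = 0 := Subtype.ext h
      simp [h'] at hm
    refine ⟨-L m m, neg_pos.mpr (hN m m.2 hm0), fun u hu => ?_⟩
    by_cases h0 : u = 0
    · simp [h0]
    have hu0 : 0 < ‖u‖ := norm_pos_iff.mpr h0
    have hs : (‖u‖⁻¹ • (⟨u, hu⟩ : N)) ∈ Metric.sphere (0 : N) 1 := by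
      rw [mem_sphere_zero_iff_norm, norm_smul]
      simp [h0]
    have h1 : L (‖u‖⁻¹ • u) (‖u‖⁻¹ • u) ≤ L m m := hmax hs
    simp only [map_smul, smul_apply, smul_eq_mul] at h1
    have h2 : L u u = ‖u‖ ^ 2 * (‖u‖⁻¹ * (‖u‖⁻¹ * L u u)) := by
      field_simp
    rw [h2]
    nlinarith [sq_nonneg ‖u‖]

/-- Cauchy–Schwarz for a semidefinite form, from the discriminant of `t ↦ ⟨L(u + tv), u + tv⟩`. -/
theorem sq_apply_le_of_nonneg {L : X →L[ℝ] StrongDual ℝ X} (hsymm : ∀ u v, L u v = L v u)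
    {P : Submodule ℝ X} (hP : ∀ u ∈ P, 0 ≤ L u u) {u v : X} (hu : u ∈ P) (hv : v ∈ P) :
    L u v ^ 2 ≤ L u u * L v v := by
  have h : ∀ t : ℝ, 0 ≤ L v v * (t * t) + 2 * L u v * t + L u u := by
    intro t
    have := hP (u + t • v) (P.add_mem hu (P.smul_mem t hv))
    simp only [map_add, map_smul, add_apply, smul_apply,
      smul_eq_mul, hsymm v u] at this
    linarith
  have := discrim_le_zero h
  unfold discrim at this
  linarith

theorem rank_le_of_nonpos {L : X →L[ℝ] StrongDual ℝ X} {Xm Xp : Submodule ℝ X}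
    [FiniteDimensional ℝ Xm] (hc : IsCompl Xm Xp) (hpos : ∀ u ∈ Xp, u ≠ 0 → 0 < L u u)
    (W : Submodule ℝ X) (hW : ∀ u ∈ W, L u u ≤ 0) :
    Module.rank ℝ W ≤ (finrank ℝ Xm : Cardinal) := by
  rw [finrank_eq_rank]
  apply LinearMap.rank_le_of_injective ((Xm.projectionOnto Xp hc).domRestrict W)
  rw [← LinearMap.ker_eq_bot, LinearMap.ker_eq_bot']
  intro w hw
  have hwp : (w : X) ∈ Xp := (Submodule.projectionOnto_apply_eq_zero_iff hc).mp hw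
  by_contra hne
  exact absurd (hpos w hwp fun h => hne (Subtype.ext h)) (not_lt.mpr (hW w w.2))

/-- A finite-dimensional negative definite subspace can be moved into a dense subspace. -/
theorem exists_negative_le_of_dense (L : X →L[ℝ] StrongDual ℝ X) (M : Submodule ℝ X)
    [FiniteDimensional ℝ M] (hM : ∀ u ∈ M, u ≠ 0 → L u u < 0) (D : Submodule ℝ X)
    (hD : Dense (D : Set X)) :
    ∃ N : Submodule ℝ X, N ≤ D ∧ FiniteDimensional ℝ N ∧ finrank ℝ N = finrank ℝ M ∧
      ∀ u ∈ N, u ≠ 0 → L u u < 0 := by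
  let b := finBasis ℝ M
  let s : (Fin (finrank ℝ M) → X) → (Fin (finrank ℝ M) → ℝ) → X := fun x c => ∑ i, c i • x i
  have hs : Continuous fun p : (Fin (finrank ℝ M) → X) × (Fin (finrank ℝ M) → ℝ) =>
      L (s p.1 p.2) (s p.1 p.2) := by
    have : Continuous fun p : (Fin (finrank ℝ M) → X) × (Fin (finrank ℝ M) → ℝ) =>
      s p.1 p.2 := by fun_prop
    exact (L.continuous.comp this).clm_apply this
  -- Compactness of the coefficient sphere makes negativity of the span an open condition on the
  -- tuple, so a tuple from `D` near the basis satisfies it.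
  have hev : ∀ᶠ x in 𝓝 (fun i => (b i : X)),
      ∀ c ∈ Metric.sphere (0 : Fin (finrank ℝ M) → ℝ) 1, L (s x c) (s x c) < 0 := by
    apply (isCompact_sphere _ _).eventually_forall_of_forall_eventually
    intro c hc
    apply hs.continuousAt.eventually_lt continuousAt_const
    have hsb : s (fun i => (b i : X)) c = (∑ i, c i • b i : M) := by simp [s]
    change L (s _ c) (s _ c) < 0
    rw [hsb]
    apply hM _ (Subtype.property _)
    intro h0
    have h1 : c = 0 := by
      have := Fintype.linearIndependent_iff.mp b.linearIndependent c (Subtype.ext h0)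
      exact funext this
    rw [h1] at hc
    simp at hc
  have hdense : Dense (Set.univ.pi fun _ : Fin (finrank ℝ M) => (D : Set X)) :=
    dense_pi _ fun _ _ => hD
  obtain ⟨x, hx, hxD⟩ := (mem_closure_iff_nhds.mp (hdense fun i => (b i : X))) _ hev
  have hneg : ∀ c : Fin (finrank ℝ M) → ℝ, c ≠ 0 → L (s x c) (s x c) < 0 := by
    intro c hc
    have hc0 : 0 < ‖c‖ := norm_pos_iff.mpr hc
    have h1 := hx (‖c‖⁻¹ • c) (by rw [mem_sphere_zero_iff_norm, norm_smul]; simp [hc])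
    have h2 : s x (‖c‖⁻¹ • c) = ‖c‖⁻¹ • s x c := by
      simp [s, Finset.smul_sum, mul_smul]
    rw [h2] at h1
    simp only [map_smul, smul_apply, smul_eq_mul] at h1
    by_contra! h3
    exact absurd h1 (not_lt.mpr (by positivity))
  refine ⟨Submodule.span ℝ (Set.range x), ?_, .span_of_finite ℝ (Set.finite_range x), ?_, ?_⟩
  · rw [Submodule.span_le]
    rintro _ ⟨i, rfl⟩
    exact hxD i trivial
  · have hli : LinearIndependent ℝ x := by
      rw [Fintype.linearIndependent_iff]
      intro c hc i
      by_contra hne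
      have h1 := hneg c fun h => hne (congrFun h i)
      have h2 : s x c = 0 := hc
      simp [h2] at h1
    rw [finrank_span_eq_card hli, Fintype.card_fin]
  · intro u hu hne
    obtain ⟨c, rfl⟩ := (Submodule.mem_span_range_iff_exists_fun ℝ).mp hu
    apply hneg c
    rintro rfl
    simp at hne

/-- The orthogonal complement of a maximal negative definite subspace is positive definite. -/
theorem pos_of_mem_perp {L : X →L[ℝ] StrongDual ℝ X} (hsymm : ∀ u v, L u v = L v u)
    {N : Submodule ℝ X} [FiniteDimensional ℝ N] (hN : ∀ u ∈ N, u ≠ 0 → L u u < 0)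
    (hmax : ∀ W : Submodule ℝ X, (∀ u ∈ W, L u u ≤ 0) →
      Module.rank ℝ W ≤ (finrank ℝ N : Cardinal)) {p : X} (hp : p ∈ perp (formOf L) N)
    (hp0 : p ≠ 0) : 0 < L p p := by
  by_contra! hle
  have hpN : p ∉ N := fun h => (hN p h hp0).ne (hp p h)
  -- Adjoining `p` would give a nonpositive subspace of dimension `dim N + 1`.
  have h1 := hmax (N ⊔ Submodule.span ℝ {p}) (by
    intro u hu
    obtain ⟨n, hn, _, hy, rfl⟩ := Submodule.mem_sup.mp hu
    obtain ⟨t, rfl⟩ := Submodule.mem_span_singleton.mp hy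
    have h1 : L n n ≤ 0 := by
      by_cases h : n = 0
      · simp [h]
      · exact (hN n hn h).le
    have h2 : L p n = 0 := hp n hn
    simp only [map_add, map_smul, add_apply, smul_apply,
      smul_eq_mul, hsymm n p, h2]
    nlinarith [mul_self_nonneg t])
  rw [← finrank_eq_rank, Nat.cast_le] at h1
  have h2 := Submodule.finrank_sup_add_finrank_inf_eq N (Submodule.span ℝ {p})
  have h3 : N ⊓ Submodule.span ℝ {p} = ⊥ :=
    (((Submodule.disjoint_span_singleton' hp0).mpr hpN)).eq_bot
  rw [h3, finrank_bot, finrank_span_singleton hp0] at h2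
  omega

/-- A Pontryagin space splits along a maximal negative definite subspace into a finite-dimensional
uniformly negative and a uniformly positive subspace. -/
theorem exists_projection {L : X →L[ℝ] StrongDual ℝ X} (hsymm : ∀ u v, L u v = L v u)
    {c : ℝ} (hc : 0 < c) (hbd : ∀ v, c * ‖v‖ ≤ ‖L v‖)
    {N : Submodule ℝ X} [FiniteDimensional ℝ N] (hN : ∀ u ∈ N, u ≠ 0 → L u u < 0)
    (hmax : ∀ W : Submodule ℝ X, (∀ u ∈ W, L u u ≤ 0) →
      Module.rank ℝ W ≤ (finrank ℝ N : Cardinal)) :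
    ∃ p : X →L[ℝ] N, (∀ x, x - p x ∈ perp (formOf L) N) ∧
      ∃ δ : ℝ, 0 < δ ∧ ∀ x ∈ perp (formOf L) N, δ * ‖x‖ ^ 2 ≤ L x x := by
  obtain ⟨ν, hν, hNν⟩ := exists_uniform_negative L N hN
  obtain ⟨p₀, hp₀⟩ := exists_orthogonal_projection (formOf L) N fun u hu h => by
    by_contra hne
    exact (hN u hu hne).ne h
  have hp₀' : ∀ x, ∀ v ∈ N, L (p₀ x) v = L x v := hp₀
  -- Continuity: `ν‖p x‖² ≤ -⟨L p x, p x⟩ = -⟨L x, p x⟩ ≤ ‖L‖‖x‖‖p x‖`.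
  let p : X →L[ℝ] N := p₀.mkContinuous (‖L‖ / ν) fun x => by
    have h1 := hNν _ (p₀ x).2
    rw [hp₀' x _ (p₀ x).2] at h1
    have h2 : |L x (p₀ x)| ≤ ‖L‖ * ‖x‖ * ‖(p₀ x : X)‖ := L.le_opNorm₂ x _
    have h3 := neg_le_of_abs_le h2
    rw [div_mul_eq_mul_div, le_div_iff₀ hν]
    rcases (norm_nonneg (p₀ x : X)).eq_or_lt with h | h
    · rw [Submodule.coe_norm, ← h, zero_mul]
      positivity
    · rw [Submodule.coe_norm]
      nlinarith
  have hpp : ∀ x, x - p x ∈ perp (formOf L) N := by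
    intro x v hv
    change L (x - p₀ x) v = 0
    rw [map_sub, sub_apply, hp₀' x v hv, sub_self]
  refine ⟨p, hpp, ?_⟩
  have hpos : ∀ x ∈ perp (formOf L) N, 0 ≤ L x x := by
    intro x hx
    by_cases h : x = 0
    · simp [h]
    · exact (pos_of_mem_perp hsymm hN hmax hx h).le
  set K : ℝ := ‖L‖ * (1 + ‖p‖) ^ 2 + 1 with hK
  have hK0 : 0 < K := by positivity
  refine ⟨c ^ 2 / K, by positivity, fun x hx => ?_⟩
  have hxx := hpos x hx
  -- Cauchy–Schwarz on `N^⊥` bounds `‖L x‖²` by `K⟨L x, x⟩`; with `c‖x‖ ≤ ‖L x‖` this turns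
  -- positivity into uniform positivity.
  have h1 : ‖L x‖ ≤ Real.sqrt (L x x * K) := by
    apply ContinuousLinearMap.opNorm_le_bound _ (Real.sqrt_nonneg _)
    intro y
    have h2 : L x y = L x (y - p y) := by
      have : L x (p y) = 0 := hx _ (p y).2
      rw [map_sub, this, sub_zero]
    have h3 := sq_apply_le_of_nonneg hsymm hpos hx (hpp y)
    have h4 : L (y - p y) (y - p y) ≤ K * ‖y‖ ^ 2 := by
      have h5 : ‖y - p y‖ ≤ (1 + ‖p‖) * ‖y‖ := by
        have := p.le_opNorm y
        rw [Submodule.coe_norm] at this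
        calc ‖y - p y‖ ≤ ‖y‖ + ‖(p y : X)‖ := norm_sub_le _ _
          _ ≤ _ := by linarith
      have h6 := (le_abs_self _).trans (L.le_opNorm₂ (y - p y) (y - p y))
      have h7 : ‖y - p y‖ * ‖y - p y‖ ≤ ((1 + ‖p‖) * ‖y‖) * ((1 + ‖p‖) * ‖y‖) := by gcongr
      have h8 := mul_le_mul_of_nonneg_left h7 (norm_nonneg L)
      rw [hK]
      nlinarith [sq_nonneg ‖y‖]
    rw [Real.norm_eq_abs, h2]
    apply abs_le_of_sq_le_sq _ (by positivity)
    rw [mul_pow, Real.sq_sqrt (by positivity)]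
    calc _ ≤ _ := h3
      _ ≤ L x x * (K * ‖y‖ ^ 2) := by gcongr
      _ = _ := by ring
  have h2 := (hbd x).trans h1
  rw [div_mul_eq_mul_div, div_le_iff₀ hK0, ← mul_pow]
  calc (c * ‖x‖) ^ 2 ≤ Real.sqrt (L x x * K) ^ 2 := by gcongr
    _ = _ := Real.sq_sqrt (by positivity)

/-- Bounded families in a Hilbert space converge weakly along ultrafilters. -/
theorem exists_weak_limit [CompleteSpace X] {ι : Type*} (F : Ultrafilter ι) {x : ι → X} {C : ℝ}
    (hx : ∀ i, ‖x i‖ ≤ C) :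
    ∃ a : X, ∀ f : StrongDual ℝ X, Tendsto (fun i => f (x i)) F (𝓝 (f a)) := by
  let g : ι → WeakDual ℝ X := fun i => StrongDual.toWeakDual (InnerProductSpace.toDual ℝ X (x i))
  have hK := WeakDual.isCompact_closedBall (𝕜 := ℝ) (0 : StrongDual ℝ X) C
  have hgK : ∀ i, g i ∈ WeakDual.toStrongDual ⁻¹' Metric.closedBall (0 : StrongDual ℝ X) C := by
    intro i
    change InnerProductSpace.toDual ℝ X (x i) ∈ Metric.closedBall 0 C
    rw [mem_closedBall_zero_iff, LinearIsometryEquiv.norm_map]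
    exact hx i
  obtain ⟨φ, _, hφ⟩ := hK.ultrafilter_le_nhds (F.map g)
    (le_principal_iff.mpr (Ultrafilter.mem_map.mpr (Filter.univ_mem' hgK)))
  refine ⟨(InnerProductSpace.toDual ℝ X).symm (WeakDual.toStrongDual φ), fun f => ?_⟩
  let y := (InnerProductSpace.toDual ℝ X).symm f
  have hf : ∀ z, f z = inner ℝ z y := by
    intro z
    rw [real_inner_comm]
    exact InnerProductSpace.toDual_symm_apply.symm
  have h1 : Tendsto (fun i => g i y) F (𝓝 (φ y)) :=
    ((WeakDual.eval_continuous y).tendsto φ).comp hφ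
  rw [hf, InnerProductSpace.toDual_symm_apply]
  simp only [hf]
  exact h1

end Forms

/-! ### Pontryagin's invariant subspace theorem by compressions and weak limits. -/

section Invariant

variable {X : Type*} [NormedAddCommGroup X] [InnerProductSpace ℝ X]

/-- The inclusion `-J ⊂ J*`. -/
theorem IsAntiSelfDual.skew {J : StrongDual ℝ X →ₗ.[ℝ] X} (hJ : IsAntiSelfDual J)
    (f g : J.domain) : (f : StrongDual ℝ X) (J g) = -(g : StrongDual ℝ X) (J f) := by
  have h : ((f : StrongDual ℝ X), NormedSpace.inclusionInDoubleDual ℝ X (-J f)) ∈ dualGraph J := by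
    rw [← dualOp_graph J hJ.1, hJ.2]
    exact (LinearPMap.mem_graph_iff _).mpr ⟨f, rfl, rfl⟩
  have h' := h g
  simp only [map_neg] at h'
  exact h'.symm

/-- The inclusion `J* ⊂ -J`, which lets a weak identity prove membership in the domain. -/
theorem IsAntiSelfDual.mem_domain {J : StrongDual ℝ X →ₗ.[ℝ] X} (hJ : IsAntiSelfDual J)
    {f : StrongDual ℝ X} {z : X} (h : ∀ g : J.domain, f (J g) = -(g : StrongDual ℝ X) z) :
    ∃ hf : f ∈ J.domain, J ⟨f, hf⟩ = z := by
  have hg : (f, NormedSpace.inclusionInDoubleDual ℝ X (-z)) ∈ dualGraph J := by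
    intro g
    simp only [map_neg]
    exact (h g).symm
  rw [← dualOp_graph J hJ.1, hJ.2] at hg
  obtain ⟨f', hf', hz⟩ := (LinearPMap.mem_graph_iff _).mp hg
  subst hf'
  refine ⟨f'.2, ?_⟩
  have h1 : -J f' = -z := (NormedSpace.inclusionInDoubleDualLi ℝ (E := X)).injective hz
  exact neg_injective h1

theorem opJL_skew {J : StrongDual ℝ X →ₗ.[ℝ] X} (hJ : IsAntiSelfDual J)
    {L : X →L[ℝ] StrongDual ℝ X} (hsymm : ∀ u v, L u v = L v u) (u v : (opJL J L).domain) :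
    L (opJL J L u) v = -L u (opJL J L v) := by
  rw [hsymm]
  exact hJ.skew ⟨L v, v.2⟩ ⟨L u, u.2⟩

/-- Surjectivity of `L` makes the functionals `L v` exhaust `D(J)`, so maximality of `J` transfers
to `JL`. -/
theorem opJL_maximal {J : StrongDual ℝ X →ₗ.[ℝ] X} (hJ : IsAntiSelfDual J)
    {L : X →L[ℝ] StrongDual ℝ X} (hsymm : ∀ u v, L u v = L v u) (hsurj : Function.Surjective L)
    {w z : X} (h : ∀ v : (opJL J L).domain, L w (opJL J L v) = -L z v) :
    ∃ hw : w ∈ (opJL J L).domain, opJL J L ⟨w, hw⟩ = z := by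
  apply hJ.mem_domain
  rintro ⟨g, hg⟩
  obtain ⟨v, rfl⟩ := hsurj g
  change _ = -L v z
  rw [hsymm v z]
  exact h ⟨v, hg⟩

/-- Pontryagin's theorem for the compression of a skew operator to a finite-dimensional subspace
of its domain. -/
theorem exists_invariant_compression {L : X →L[ℝ] StrongDual ℝ X}
    (hsymm : ∀ u v, L u v = L v u) {A : X →ₗ.[ℝ] X}
    (hA : ∀ u v : A.domain, L (A u) v = -L u (A v)) {N : Submodule ℝ X}
    (hN : ∀ u ∈ N, u ≠ 0 → L u u < 0) (hpos : ∀ x ∈ perp (formOf L) N, x ≠ 0 → 0 < L x x)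
    {V : Submodule ℝ X} [FiniteDimensional ℝ V] (hNV : N ≤ V) (hV : V ≤ A.domain) :
    ∃ W ≤ V, (∀ w ∈ W, L w w ≤ 0) ∧ finrank ℝ N ≤ finrank ℝ W ∧
      ∀ w ∈ W, ∃ z ∈ W, ∀ v (hv : v ∈ V), L w (A ⟨v, hV hv⟩) = -L z v := by
  let B : V →ₗ[ℝ] V →ₗ[ℝ] ℝ := (formOf L).domRestrict₁₂ V V
  -- A vector in the radical of `V` is orthogonal to `N ⊂ V` and isotropic, hence zero.
  have hBinj : Function.Injective B := by
    rw [← LinearMap.ker_eq_bot, LinearMap.ker_eq_bot']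
    intro u hu
    by_contra hne
    refine (hpos u (fun n hn => LinearMap.congr_fun hu ⟨n, hNV hn⟩)
      fun h => hne (Subtype.ext h)).ne' (LinearMap.congr_fun hu u)
  let e : V ≃ₗ[ℝ] Dual ℝ V :=
    LinearEquiv.ofInjectiveOfFinrankEq B hBinj (Subspace.dual_finrank_eq).symm
  let T : V →ₗ[ℝ] V := e.symm.toLinearMap ∘ₗ (LinearMap.lcomp ℝ ℝ V.subtype) ∘ₗ formOf L ∘ₗ
    A.toFun ∘ₗ Submodule.inclusion hV
  have hT : ∀ u v : V, B (T u) v = L (A ⟨u, hV u.2⟩) v := by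
    intro u v
    have : e (T u) = LinearMap.lcomp ℝ ℝ V.subtype (formOf L (A ⟨u, hV u.2⟩)) :=
      e.apply_symm_apply _
    exact LinearMap.congr_fun this v
  have hB : ∀ u v, B u v = B v u := fun u v => hsymm u v
  have hTskew : ∀ u v, B (T u) v = -B u (T v) := by
    intro u v
    rw [hB u, hT, hT, hA ⟨u, hV u.2⟩ ⟨v, hV v.2⟩, hsymm]
  obtain ⟨W, hW1, hW2, hW3⟩ := exists_invariant_nonpos_of_finrank _ hB hTskew
    (N := N.comap V.subtype) (fun u hu hne => hN u hu fun h => hne (Subtype.ext h)) rfl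
  refine ⟨W.map V.subtype, ?_, ?_, ?_, ?_⟩
  · rintro _ ⟨w, _, rfl⟩
    exact w.2
  · rintro _ ⟨w, hw, rfl⟩
    exact hW2 w hw
  · rw [← (Submodule.equivMapOfInjective _ V.injective_subtype W).finrank_eq,
      ← (Submodule.comapSubtypeEquivOfLe hNV).finrank_eq]
    exact hW3
  · rintro _ ⟨w, hw, rfl⟩
    refine ⟨T w, ⟨_, hW1 w hw, rfl⟩, fun v hv => ?_⟩
    have := hT w ⟨v, hv⟩
    rw [hA ⟨w, hV w.2⟩ ⟨v, hV hv⟩] at this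
    change L w _ = -B (T w) ⟨v, hv⟩
    rw [this, neg_neg]

/-- The weak limits along `F` of the bounded families with values in the subspaces `W i`. -/
def weakLimits {ι : Type*} (F : Filter ι) (W : ι → Submodule ℝ X) : Submodule ℝ X where
  carrier := {w | ∃ x : ι → X, (∀ i, x i ∈ W i) ∧ (∃ C : ℝ, ∀ i, ‖x i‖ ≤ C) ∧
    ∀ f : StrongDual ℝ X, Tendsto (fun i => f (x i)) F (𝓝 (f w))}
  add_mem' := by
    rintro a b ⟨x, hx, ⟨C, hC⟩, hxa⟩ ⟨y, hy, ⟨C', hC'⟩, hyb⟩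
    refine ⟨x + y, fun i => add_mem (hx i) (hy i),
      ⟨C + C', fun i => (norm_add_le _ _).trans (add_le_add (hC i) (hC' i))⟩, fun f => ?_⟩
    simpa using (hxa f).add (hyb f)
  zero_mem' := ⟨0, fun i => zero_mem _, ⟨0, fun i => by simp⟩, fun f => by simpa using tendsto_const_nhds⟩
  smul_mem' := by
    rintro t a ⟨x, hx, ⟨C, hC⟩, hxa⟩
    refine ⟨t • x, fun i => Submodule.smul_mem _ t (hx i), ⟨|t| * C, fun i => ?_⟩, fun f => ?_⟩
    · rw [Pi.smul_apply, norm_smul, Real.norm_eq_abs]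
      exact mul_le_mul_of_nonneg_left (hC i) (abs_nonneg t)
    · simpa using (hxa f).const_mul t

/-- A continuous linear map of finite rank takes weakly convergent families to convergent ones. -/
theorem tendsto_of_weak {ι : Type*} {F : Filter ι} {x : ι → X} {a : X} {N : Submodule ℝ X}
    [FiniteDimensional ℝ N]
    (hx : ∀ f : StrongDual ℝ X, Tendsto (fun i => f (x i)) F (𝓝 (f a))) (p : X →L[ℝ] N) :
    Tendsto (fun i => p (x i)) F (𝓝 (p a)) := by
  let e : N ≃L[ℝ] (Fin (finrank ℝ N) → ℝ) := (finBasis ℝ N).equivFunL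
  have h : Tendsto (fun i => e (p (x i))) F (𝓝 (e (p a))) := by
    rw [tendsto_pi_nhds]
    intro k
    exact hx ((ContinuousLinearMap.proj (R := ℝ) (φ := fun _ => ℝ) k).comp
      (e.toContinuousLinearMap.comp p))
  simpa [Function.comp_def] using (e.symm.continuous.tendsto _).comp h

theorem apply_eq_add_of_projection {L : X →L[ℝ] StrongDual ℝ X} (hsymm : ∀ u v, L u v = L v u)
    {N : Submodule ℝ X} {p : X →L[ℝ] N} (hp : ∀ x, x - p x ∈ perp (formOf L) N) (x : X) :
    L x x = L (p x) (p x) + L (x - p x) (x - p x) := by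
  have h : L (x - p x) (p x) = 0 := hp x _ (p x).2
  have h' : L (p x) (x - p x) = 0 := by rw [hsymm, h]
  conv_lhs => rw [← add_sub_cancel (p x : X) x]
  simp only [map_add, add_apply, h, h']
  ring

/-- Nonpositivity of an indefinite form passes to weak limits. -/
theorem nonpos_of_weak {ι : Type*} {F : Filter ι} [F.NeBot] {L : X →L[ℝ] StrongDual ℝ X}
    (hsymm : ∀ u v, L u v = L v u) {N : Submodule ℝ X} [FiniteDimensional ℝ N] {p : X →L[ℝ] N}
    (hp : ∀ x, x - p x ∈ perp (formOf L) N) (hpos : ∀ x ∈ perp (formOf L) N, 0 ≤ L x x)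
    {x : ι → X} (hx : ∀ i, L (x i) (x i) ≤ 0) {a : X}
    (hxa : ∀ f : StrongDual ℝ X, Tendsto (fun i => f (x i)) F (𝓝 (f a))) : L a a ≤ 0 := by
  have h1 : Tendsto (fun i => L (p (x i) - p a) (p (x i) - p a : X)) F (𝓝 0) := by
    have h2 : Tendsto (fun i => ((p (x i) - p a : N) : X)) F (𝓝 ((p a - p a : N) : X)) :=
      (continuous_subtype_val.tendsto _).comp ((tendsto_of_weak hxa p).sub_const (p a))
    rw [sub_self, Submodule.coe_zero] at h2
    have h3 := ((L.continuous.clm_apply continuous_id).tendsto 0).comp h2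
    simpa [Function.comp_def] using h3
  have h4 : Tendsto (fun i => -2 * L a (x i) + L a a) F (𝓝 (-2 * L a a + L a a)) :=
    ((hxa (L a)).const_mul _).add_const _
  -- `⟨L(xᵢ - a), xᵢ - a⟩` dominates its `N`-part, which tends to `0`, and is at most `-2⟨L a, xᵢ⟩ +
  -- ⟨L a, a⟩`, which tends to `-⟨L a, a⟩`.
  have h5 := le_of_tendsto_of_tendsto h1 h4 (Filter.Eventually.of_forall fun i => by
    have h6 := apply_eq_add_of_projection hsymm hp (x i - a)
    have h7 := hpos _ (hp (x i - a))
    have h8 := hx i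
    have h9 : L (x i - a) (x i - a) = L (x i) (x i) - 2 * L a (x i) + L a a := by
      simp only [map_sub, sub_apply, hsymm (x i) a]
      ring
    have h10 : ((p (x i - a) : N) : X) = p (x i) - p a := by simp
    rw [h10] at h6
    simp only
    rw [← h10] at h6 ⊢
    linarith)
  linarith

/-- **Pontryagin's invariant subspace theorem** for an operator that is anti-self-adjoint with
respect to a nondegenerate form of finite negative index. -/
theorem exists_invariant_nonpos [CompleteSpace X] {L : X →L[ℝ] StrongDual ℝ X}
    (hsymm : ∀ u v, L u v = L v u) {c : ℝ} (hc : 0 < c) (hbd : ∀ v, c * ‖v‖ ≤ ‖L v‖)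
    {A : X →ₗ.[ℝ] X} (hA : ∀ u v : A.domain, L (A u) v = -L u (A v))
    (hAmax : ∀ {w z : X}, (∀ v : A.domain, L w (A v) = -L z v) →
      ∃ hw : w ∈ A.domain, A ⟨w, hw⟩ = z)
    {N : Submodule ℝ X} [FiniteDimensional ℝ N] (hNA : N ≤ A.domain)
    (hN : ∀ u ∈ N, u ≠ 0 → L u u < 0)
    (hmax : ∀ W : Submodule ℝ X, (∀ u ∈ W, L u u ≤ 0) →
      Module.rank ℝ W ≤ (finrank ℝ N : Cardinal)) :
    ∃ W : Submodule ℝ X, W ≤ A.domain ∧ Module.rank ℝ W = (finrank ℝ N : Cardinal) ∧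
      (∀ u : A.domain, (u : X) ∈ W → A u ∈ W) ∧ ∀ u ∈ W, L u u ≤ 0 := by
  obtain ⟨ν, hν, hNν⟩ := exists_uniform_negative L N hN
  obtain ⟨p, hp, δ, hδ, hPδ⟩ := exists_projection hsymm hc hbd hN hmax
  have hpos : ∀ x ∈ perp (formOf L) N, x ≠ 0 → 0 < L x x := fun x hx =>
    pos_of_mem_perp hsymm hN hmax hx
  have hpos' : ∀ x ∈ perp (formOf L) N, 0 ≤ L x x := fun x hx =>
    le_trans (by positivity) (hPδ x hx)
  have hpN : ∀ n : N, p n = n := by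
    intro n
    by_contra hne
    have hmem : (n - p n : X) ∈ N := sub_mem n.2 (p n).2
    have hne' : (n - p n : X) ≠ 0 := fun h => hne (Subtype.ext (sub_eq_zero.mp h).symm)
    exact (hN _ hmem hne').ne (hp n _ hmem)
  -- For nonpositive `x`, `δ‖x - p x‖² ≤ -⟨L p x, p x⟩ ≤ ‖L‖‖p x‖²`.
  have hgraph : ∀ x, L x x ≤ 0 → ‖x‖ ≤ (1 + Real.sqrt (‖L‖ / δ)) * ‖p x‖ := by
    intro x hx
    have h1 := apply_eq_add_of_projection hsymm hp x
    have h2 := hPδ _ (hp x)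
    have h3 := neg_le_of_abs_le (L.le_opNorm₂ (p x : X) (p x))
    have h4 : ‖x - p x‖ ≤ Real.sqrt (‖L‖ / δ) * ‖p x‖ := by
      apply abs_le_of_sq_le_sq' _ (by positivity) |>.2
      rw [mul_pow, Real.sq_sqrt (by positivity), div_mul_eq_mul_div, le_div_iff₀ hδ]
      rw [Submodule.coe_norm]
      linarith
    calc ‖x‖ = ‖(p x : X) + (x - p x)‖ := by rw [add_sub_cancel]
      _ ≤ ‖(p x : X)‖ + ‖x - p x‖ := norm_add_le _ _
      _ ≤ _ := by
        rw [← Submodule.coe_norm]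
        linarith
  let V : Finset A.domain → Submodule ℝ X := fun F =>
    N ⊔ Submodule.span ℝ ((fun v : A.domain => (v : X)) '' (F : Set A.domain))
  have hVfin : ∀ F, FiniteDimensional ℝ (V F) := fun F => by
    have : FiniteDimensional ℝ
        (Submodule.span ℝ ((fun v : A.domain => (v : X)) '' (F : Set A.domain))) :=
      .span_of_finite ℝ (F.finite_toSet.image _)
    exact Submodule.finiteDimensional_sup _ _
  have hVA : ∀ F, V F ≤ A.domain := fun F => by
    refine sup_le hNA (Submodule.span_le.mpr ?_)
    rintro _ ⟨v, _, rfl⟩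
    exact v.2
  have hVmem : ∀ F : Finset A.domain, ∀ v ∈ F, (v : X) ∈ V F := fun F v hv =>
    Submodule.mem_sup_right (Submodule.subset_span ⟨v, hv, rfl⟩)
  choose W hWV hWneg hWdim hWinv using fun F =>
    exists_invariant_compression hsymm hA hN hpos (V := V F) le_sup_left (hVA F)
  have hWfin : ∀ F, FiniteDimensional ℝ (W F) := fun F =>
    Submodule.finiteDimensional_of_le (hWV F)
  have hlift : ∀ F, ∀ n : N, ∃ w ∈ W F, p w = n := by
    intro F n
    have hinj : Function.Injective (p.toLinearMap.domRestrict (W F)) := by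
      rw [← LinearMap.ker_eq_bot, LinearMap.ker_eq_bot']
      intro w hw
      have hw' : p w = 0 := hw
      have := hgraph w (hWneg F w w.2)
      rw [hw', norm_zero, mul_zero] at this
      exact Subtype.ext (norm_le_zero_iff.mp this)
    have hdim : finrank ℝ (W F) = finrank ℝ N :=
      le_antisymm (LinearMap.finrank_le_finrank_of_injective hinj) (hWdim F)
    obtain ⟨w, hw⟩ := (LinearMap.injective_iff_surjective_of_finrank_eq_finrank hdim).mp hinj n
    exact ⟨w, w.2, hw⟩
  let a : N →L[ℝ] X := LinearMap.toContinuousLinearMap (A.toFun ∘ₗ Submodule.inclusion hNA)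
  have ha : ∀ n : N, A ⟨n, hNA n.2⟩ = a n := fun n => rfl
  -- Testing with `v = p z ∈ N` gives `ν‖p z‖² ≤ -⟨L z, p z⟩ = ⟨L w, A p z⟩`, where only the bounded
  -- restriction `a` of `A` to `N` enters.
  have hbound : ∀ F, ∀ w, ∀ z ∈ W F, (∀ v (hv : v ∈ V F), L w (A ⟨v, hVA F hv⟩) = -L z v) →
      ‖z‖ ≤ (1 + Real.sqrt (‖L‖ / δ)) * (‖L‖ * ‖a‖ / ν * ‖w‖) := by
    intro F w z hz h
    refine (hgraph z (hWneg F z hz)).trans (mul_le_mul_of_nonneg_left ?_ (by positivity))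
    have h1 := hNν _ (p z).2
    have h2 : L (z - p z) (p z) = 0 := hp z _ (p z).2
    rw [map_sub, sub_apply, sub_eq_zero] at h2
    have h3 := h _ (Submodule.mem_sup_left (p z).2)
    rw [h2, ha] at h3
    have h4 := (le_abs_self _).trans (L.le_opNorm₂ w (a (p z)))
    have h5 := mul_le_mul_of_nonneg_left (a.le_opNorm (p z))
      (mul_nonneg (norm_nonneg L) (norm_nonneg w))
    rw [← Submodule.coe_norm] at h1
    rw [div_mul_eq_mul_div, le_div_iff₀ hν]
    rcases (norm_nonneg (p z)).eq_or_lt with h0 | h0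
    · rw [← h0, zero_mul]
      positivity
    · refine le_of_mul_le_mul_right ?_ h0
      linarith
  -- An ultrafilter finer than `atTop` gives bounded families weak limits, while each `v ∈ D(A)`
  -- lies in `V F` eventually.
  let U : Ultrafilter (Finset A.domain) := Ultrafilter.of atTop
  have hU : (U : Filter (Finset A.domain)) ≤ atTop := Ultrafilter.of_le atTop
  have hneg : ∀ w ∈ weakLimits U W, L w w ≤ 0 := by
    rintro w ⟨x, hx, _, hxw⟩
    exact nonpos_of_weak hsymm hp hpos' (fun F => hWneg F _ (hx F)) hxw
  have hinv : ∀ w ∈ weakLimits U W, ∃ hw : w ∈ A.domain, A ⟨w, hw⟩ ∈ weakLimits U W := by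
    rintro w ⟨x, hx, ⟨C, hC⟩, hxw⟩
    choose y hy hxy using fun F => hWinv F (x F) (hx F)
    have hyb : ∀ F, ‖y F‖ ≤ (1 + Real.sqrt (‖L‖ / δ)) * (‖L‖ * ‖a‖ / ν * C) := fun F =>
      (hbound F _ _ (hy F) (hxy F)).trans (by
        have := hC F
        gcongr)
    obtain ⟨z, hz⟩ := exists_weak_limit U hyb
    obtain ⟨hw, hwz⟩ := hAmax (w := w) (z := z) fun v => by
      have h1 : Tendsto (fun F => L (A v) (x F)) U (𝓝 (L (A v) w)) := hxw _
      have h2 : Tendsto (fun F => -L v (y F)) U (𝓝 (-L v z)) := (hz (L v)).neg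
      rw [hsymm w, hsymm z]
      refine tendsto_nhds_unique_of_eventuallyEq h1 h2 (hU ?_)
      filter_upwards [eventually_ge_atTop {v}] with F hF
      rw [hsymm (A v), hsymm v]
      exact hxy F v (hVmem F v (hF (Finset.mem_singleton_self v)))
    exact ⟨hw, hwz ▸ ⟨y, hy, ⟨_, hyb⟩, hz⟩⟩
  refine ⟨weakLimits U W, fun w hw => (hinv w hw).1, ?_, fun u hu => (hinv u hu).2, hneg⟩
  refine le_antisymm (hmax _ hneg) ?_
  rw [finrank_eq_rank]
  -- Lifts of a fixed `n` to the subspaces `W F` are bounded by `hgraph`, and `p` of their weak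
  -- limit is `n`.
  refine LinearMap.rank_le_of_surjective (p.toLinearMap.domRestrict (weakLimits U W)) fun n => ?_
  choose x hx hxn using fun F => hlift F n
  have hxb : ∀ F, ‖x F‖ ≤ (1 + Real.sqrt (‖L‖ / δ)) * ‖n‖ := fun F => by
    have := hgraph _ (hWneg F _ (hx F))
    rwa [hxn] at this
  obtain ⟨w, hw⟩ := exists_weak_limit U hxb
  refine ⟨⟨w, x, hx, ⟨_, hxb⟩, hw⟩, ?_⟩
  have h := tendsto_of_weak hw p
  simp only [hxn] at h
  exact tendsto_nhds_unique h tendsto_const_nhds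

theorem Hypotheses.isCompl {J : StrongDual ℝ X →ₗ.[ℝ] X} {L : X →L[ℝ] StrongDual ℝ X}
    {Xm Xp : Submodule ℝ X} (h : Hypotheses J L Xm Xp) (hker : LinearMap.ker L.toLinearMap = ⊥) :
    IsCompl Xm Xp := by
  obtain ⟨hind, htop⟩ :=
    (DirectSum.isInternal_submodule_iff_iSupIndep_and_iSup_eq_top _).mp h.decomposition
  refine ⟨hind.pairwiseDisjoint (i := 0) (j := 2) (by decide), ?_⟩
  rw [codisjoint_iff, eq_top_iff, ← htop]
  refine iSup_le fun i => ?_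
  fin_cases i
  · exact le_sup_left
  · simp [hker]
  · exact le_sup_right

end Invariant

end LinHam

theorem theorem5p1 {X : Type*} [NormedAddCommGroup X] [InnerProductSpace ℝ X] [CompleteSpace X]
    (J : StrongDual ℝ X →ₗ.[ℝ] X) (L : X →L[ℝ] StrongDual ℝ X) (Xm Xp : Submodule ℝ X)
    (hJL : LinHam.Hypotheses J L Xm Xp) (hL : LinHam.IsNondegenerate L) :
    (∀ W : Submodule ℝ X, (∀ u ∈ W, L u u ≤ 0) →
      Module.rank ℝ W ≤ (Module.finrank ℝ Xm : Cardinal)) ∧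
    (∃ W : Submodule ℝ X, W ≤ (LinHam.opJL J L).domain ∧
      Module.rank ℝ W = (Module.finrank ℝ Xm : Cardinal) ∧
      (∀ u : (LinHam.opJL J L).domain, (u : X) ∈ W → LinHam.opJL J L u ∈ W) ∧
      (∀ u ∈ W, L u u ≤ 0)) := by
  have hsymm := hJL.symmetric
  have := hJL.finite_neg
  obtain ⟨c, hc, hbd⟩ := LinHam.exists_bound_below hsymm hL
  have hker : LinearMap.ker L.toLinearMap = ⊥ := by
    rw [LinearMap.ker_eq_bot']
    intro v hv
    have hv' : L v = 0 := hv
    have := hbd v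
    rw [hv', norm_zero] at this
    exact norm_le_zero_iff.mp (by nlinarith [norm_nonneg v])
  have hsurj := LinHam.surjective_of_bound_below hsymm hc hbd
  obtain ⟨δ, hδ, hpos⟩ := hJL.positive
  have hmax := LinHam.rank_le_of_nonpos (L := L) (hJL.isCompl hker) fun u hu hne =>
    lt_of_lt_of_le (by have := norm_pos_iff.mpr hne; positivity) (hpos u hu)
  refine ⟨hmax, ?_⟩
  have hdense : Dense ((LinHam.opJL J L).domain : Set X) :=
    hJL.antiSelfDual.1.preimage (L.isOpenMap hsurj)
  obtain ⟨N, hNA, hNfin, hNdim, hN⟩ :=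
    LinHam.exists_negative_le_of_dense L Xm hJL.negative _ hdense
  -- The bound by `dim X₋` becomes maximality of `N` among nonpositive subspaces.
  rw [← hNdim] at hmax ⊢
  exact LinHam.exists_invariant_nonpos hsymm hc hbd (LinHam.opJL_skew hJL.antiSelfDual hsymm)
    (LinHam.opJL_maximal hJL.antiSelfDual hsymm hsurj) hNA hN hmax
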